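/- Let $(X_i)_{i\ge1}$ be nonnegative survival times with density $f$ and distribution function $F$, and let $(C_i)_{i\ge1}$ be censoring times with density $g$ and distribution function $G$. The pairs $(X_i,C_i)$, $i\ge 1$, are i.i.d., and $X_i$ is independent of $C_i$. One observes $T_i=\min(X_i,C_i)$ and $\Delta_i=\mathbf 1_{\{X_i\le C_i\}}$. Let $\tau_F,\tau_G,\tau_H$ be the right end points of the supports of the distributions of $X_i$, $C_i$, $T_i$, and assume $\tau_H=\tau_G<\tau_F\le\infty$. For $n\ge1$ let $$F_n(t)=1-\prod_{s\le t}\Bigl(1-\frac{\#\{i\le n:T_i=s,\ \Delta_i=1\}}{\#\{i\le n:T_i\ge s\}}\Bigr)$$ be the Kaplan–Meier estimator of $F$, where $s$ ranges over the distinct values of $T_1,\dots,T_n$. Let $\tilde F_n$ be the greatest convex minorant of $F_n$ on $[0,\tau_H]$ and let $\tilde f_n$ be the left-hand slope (left derivative) of $\tilde F_n$. Let $k$ be a symmetric probability density supported on $[-1,1]$, put $k_b(u)=b^{-1}k(u/b)$, and let $b=b_n$ be bandwidths with $0<b_n\to0$ and $nb_n\to\infty$. The smoothed Grenander-type estimator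 of $f$ is $$\tilde f_n^{SG}(x)=\int_{(x-b)\vee0}^{(x+b)\wedge\tau_H}k_b(x-u)\,\tilde f_n(u)\,du,\qquad x\in[0,\tau_H].$$ Suppose that $f$ is nondecreasing and continuous on $[0,\tau_F)$. Then for each $0<\epsilon<\tau_H$, with probability one, $$\sup_{x\in[\epsilon,\tau_H-\epsilon]}\bigl|\tilde f_n^{SG}(x)-f(x)\bigr|\longrightarrow0\qquad(n\to\infty),$$ where the supremum over an empty interval is $0$. -/

import Mathlib

open MeasureTheory ProbabilityTheory Filter Topology

noncomputable section

namespace SmoothedGrenander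

/-- The right end point of the support of a distribution on the real line. -/
def endPoint (μ : Measure ℝ) : EReal := ⨆ x ∈ μ.support, (x : EReal)

/-- The follow-up time `T = min (X, C)`. -/
def followUp {Ω : Type*} (X C : Ω → ℝ) (ω : Ω) : ℝ := min (X ω) (C ω)

/-- The censoring indicator: `1` if `X ≤ C` and `0` otherwise. -/
def uncensored {Ω : Type*} (X C : Ω → ℝ) (ω : Ω) : ℝ := if X ω ≤ C ω then 1 else 0

/-- The random censorship model: the pairs `(X i, C i)` of survival and censoring times are i.i.d.,
survival and censoring times are independent, the survival times are nonnegative with density `f`,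
and the censoring times have density `g`. -/
structure RandomCensorship {Ω : Type*} [MeasurableSpace Ω] (P : Measure Ω)
    (X C : ℕ → Ω → ℝ) (f g : ℝ → ℝ) : Prop where
  measurable_survival : ∀ i, Measurable (X i)
  measurable_censoring : ∀ i, Measurable (C i)
  indep_pairs : iIndepFun (fun i ω => (X i ω, C i ω)) P
  identDistrib_pairs : ∀ i,
    IdentDistrib (fun ω => (X i ω, C i ω)) (fun ω => (X 0 ω, C 0 ω)) P P
  indep_censoring : IndepFun (X 0) (C 0) P
  measurable_f : Measurable f
  nonneg_f : ∀ x, 0 ≤ f x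
  f_eq_zero : ∀ x, x < 0 → f x = 0
  law_survival : P.map (X 0) = volume.withDensity (fun x => ENNReal.ofReal (f x))
  measurable_g : Measurable g
  nonneg_g : ∀ x, 0 ≤ g x
  law_censoring : P.map (C 0) = volume.withDensity (fun x => ENNReal.ofReal (g x))

/-- The number of subjects still at risk at time `s`. -/
def atRisk {n : ℕ} (T : Fin n → ℝ) (s : ℝ) : ℝ := ∑ i, if s ≤ T i then 1 else 0

/-- The number of uncensored observations at time `s`. -/
def deaths {n : ℕ} (T Δ : Fin n → ℝ) (s : ℝ) : ℝ := ∑ i, if T i = s then Δ i else 0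

/-- The Kaplan-Meier (product limit) estimator of the distribution function: the product runs over
the distinct observed times `s ≤ t`. -/
def kaplanMeier {n : ℕ} (T Δ : Fin n → ℝ) (t : ℝ) : ℝ :=
  1 - ∏ s ∈ (Finset.univ.image T).filter (· ≤ t), (1 - deaths T Δ s / atRisk T s)

/-- The greatest convex minorant of `F` on `s`: the pointwise supremum of all functions that are
convex on `s` and lie below `F` on `s`. -/
def gcm (s : Set ℝ) (F : ℝ → ℝ) (x : ℝ) : ℝ :=
  sSup {y | ∃ h : ℝ → ℝ, ConvexOn ℝ s h ∧ (∀ t ∈ s, h t ≤ F t) ∧ h x = y}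

/-- The Grenander-type estimator of a nondecreasing density: the left-hand slope of the greatest
convex minorant of the Kaplan-Meier estimator on `[0, τ]`. -/
def grenander {n : ℕ} (T Δ : Fin n → ℝ) (τ : ℝ) (x : ℝ) : ℝ :=
  derivWithin (gcm (Set.Icc 0 τ) (kaplanMeier T Δ)) (Set.Iio x) x

/-- A standard kernel: a symmetric probability density supported on `[-1, 1]`. -/
structure IsStandardKernel (k : ℝ → ℝ) : Prop where
  measurable : Measurable k
  nonneg : ∀ u, 0 ≤ k u
  integral_eq_one : ∫ u, k u = 1
  symm : ∀ u, k (-u) = k u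
  support_subset : Function.support k ⊆ Set.Icc (-1) 1

/-- The rescaled kernel `k_b`. -/
def scaledKernel (k : ℝ → ℝ) (b u : ℝ) : ℝ := 1 / b * k (u / b)

/-- The smoothed Grenander-type estimator of a nondecreasing density, with bandwidth `b`. -/
def smoothedGrenander {n : ℕ} (k : ℝ → ℝ) (b τ : ℝ) (T Δ : Fin n → ℝ) (x : ℝ) : ℝ :=
  ∫ u in (max (x - b) 0)..(min (x + b) τ), scaledKernel k b (x - u) * grenander T Δ τ u

end SmoothedGrenander

end

/-!
The left-hand slopes of the greatest convex minorant of the Kaplan-Meier estimator converge to the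
density uniformly on every compact subinterval of `(0, τ)`, and kernel averages inherit this.

Without tied deaths, which have probability zero, one minus the Kaplan-Meier estimator differs from
`exp (-Λ)`, with `Λ` the Nelson-Aalen estimator, by at most `n` times the squared reciprocal of the
number at risk (`abs_kaplanMeier_sub_le`), that is, by a term of order `1 / n` at times before `τ`.
The fraction at risk converges uniformly by the strong law and monotonicity, so it can be replaced by
its limit in `Λ`; the strong law then applies to the resulting average, whose mean is the cumulative
hazard `-log (1 - F t)` because the censoring factor cancels
(`RandomCensorship.integral_hazardScore`). Hence the Kaplan-Meier estimator is strongly consistent at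
each time before `τ` and, being monotone with a continuous limit, uniformly on `[0, t]` for `t < τ`.

The estimator need not be controlled near `τ`. Since it is monotone and the distribution function `F`
is continuous at `τ`, the convex function `F - δ` is eventually a minorant on all of `[0, τ]`, while
the greatest convex minorant lies below the estimator. So the minorants converge to `F` uniformly on
`[0, t]` for `t < τ` (`tendstoUniformlyOn_gcm`). For convex functions, uniform convergence passes to
the slopes when the limit has the continuous monotone derivative `f`
(`tendstoUniformlyOn_leftDeriv`). For small bandwidths the smoothing window of a point in
`[ε, τ - ε]` stays inside `(0, τ)`, where the kernel has total mass one, and the uniform continuity of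
`f` finishes the argument (`tendsto_iSup_smoothing`).
-/

namespace SmoothedGrenander

/-! ### Uniform convergence of monotone functions -/

/-- Pólya's theorem on a compact interval. Pointwise convergence is only asked for on the countable
set of points that divide the interval in a rational ratio, so that an almost sure version follows. -/
theorem tendstoUniformlyOn_of_monotoneOn_of_rat {F : ℕ → ℝ → ℝ} {G : ℝ → ℝ} {a c : ℝ}
    (hac : a < c) (hF : ∀ n, MonotoneOn (F n) (Set.Icc a c)) (hG : ContinuousOn G (Set.Icc a c))
    (hlim : ∀ q : ℚ, a + q * (c - a) ∈ Set.Icc a c →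
      Tendsto (fun n => F n (a + q * (c - a))) atTop (𝓝 (G (a + q * (c - a))))) :
    TendstoUniformlyOn F G atTop (Set.Icc a c) := by
  rw [Metric.tendstoUniformlyOn_iff]
  intro δ hδ
  have hca : 0 < c - a := sub_pos.2 hac
  have huc := isCompact_Icc.uniformContinuousOn_of_continuous hG
  rw [Metric.uniformContinuousOn_iff] at huc
  obtain ⟨η, hη, huc⟩ := huc (δ / 2) (half_pos hδ)
  obtain ⟨N, hN⟩ := exists_nat_gt ((c - a) / η)
  have hNpos : (0 : ℝ) < N := lt_of_le_of_lt (by positivity) hN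
  have hmesh : (c - a) / N < η := by
    rw [div_lt_iff₀ hNpos]; rwa [div_lt_iff₀ hη, mul_comm] at hN
  set t : ℕ → ℝ := fun i => a + ((i / N : ℚ) : ℝ) * (c - a) with ht
  have ht' : ∀ i, t i = a + (i : ℝ) * ((c - a) / N) := by
    intro i; simp only [ht]; push_cast; ring
  have htmem : ∀ i ≤ N, t i ∈ Set.Icc a c := by
    intro i hi
    have hi' : (i : ℝ) ≤ N := by exact_mod_cast hi
    rw [ht']
    constructor
    · have : 0 ≤ (i : ℝ) * ((c - a) / N) := by positivity
      linarith
    · have : (i : ℝ) * ((c - a) / N) ≤ N * ((c - a) / N) := by gcongr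
      rw [mul_div_cancel₀ _ hNpos.ne'] at this
      linarith
  have hev : ∀ᶠ n in atTop, ∀ i ∈ Finset.range (N + 1), dist (F n (t i)) (G (t i)) < δ / 2 := by
    rw [Filter.eventually_all_finset]
    intro i hi
    exact (Metric.tendsto_nhds.1 (hlim _ (htmem i (by simpa [Nat.lt_succ_iff] using hi)))) _
      (half_pos hδ)
  filter_upwards [hev] with n hn x hx
  -- `x` lies in a mesh interval `[t i, t (i + 1)]`
  obtain ⟨i, hiN, hi1, hi2⟩ : ∃ i, i + 1 ≤ N ∧ t i ≤ x ∧ x ≤ t (i + 1) := by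
    rcases eq_or_lt_of_le hx.2 with rfl | hxc
    · obtain ⟨M, rfl⟩ : ∃ M, N = M + 1 :=
        Nat.exists_eq_succ_of_ne_zero (by rintro rfl; simp at hNpos)
      refine ⟨M, le_rfl, (htmem M (Nat.le_succ M)).2, ?_⟩
      rw [ht', mul_div_cancel₀ _ hNpos.ne']; linarith
    · set y := (x - a) / ((c - a) / N) with hy
      have hm : 0 < (c - a) / N := by positivity
      have hy0 : 0 ≤ y := div_nonneg (by linarith [hx.1]) hm.le
      have hxy : x = a + y * ((c - a) / N) := by rw [hy, div_mul_cancel₀ _ hm.ne']; ring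
      refine ⟨⌊y⌋₊, ?_, ?_, ?_⟩
      · rw [Nat.succ_le_iff, Nat.floor_lt hy0, hy, div_lt_iff₀ hm, mul_div_cancel₀ _ hNpos.ne']
        linarith
      · rw [ht']
        have := mul_le_mul_of_nonneg_right (Nat.floor_le hy0) hm.le
        linarith
      · rw [ht']
        have := mul_le_mul_of_nonneg_right (Nat.lt_floor_add_one y).le hm.le
        push_cast
        linarith
  have hm1 := htmem i (by omega)
  have hm2 := htmem (i + 1) hiN
  have hgap : t (i + 1) - t i = (c - a) / N := by rw [ht', ht']; push_cast; ring
  have h1 := hn i (by simp; omega)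
  have h2 := hn (i + 1) (by simp; omega)
  have h3 := huc x hx (t i) hm1 (by rw [Real.dist_eq, abs_lt]; constructor <;> linarith)
  have h4 := huc x hx (t (i + 1)) hm2 (by rw [Real.dist_eq, abs_lt]; constructor <;> linarith)
  have h5 := hF n hm1 hx hi1
  have h6 := hF n hx hm2 hi2
  rw [Real.dist_eq, abs_lt] at *
  constructor <;> linarith

/-! ### Greatest convex minorants -/

section gcm

variable {s : Set ℝ} {F h : ℝ → ℝ} {x : ℝ}

/-- A convex minorant lies below the greatest convex minorant; `F x` bounds the set whose supremum
is taken. -/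
theorem le_gcm (hh : ConvexOn ℝ s h) (hle : ∀ t ∈ s, h t ≤ F t) (hx : x ∈ s) :
    h x ≤ gcm s F x :=
  le_csSup ⟨F x, by rintro _ ⟨h', -, hle', rfl⟩; exact hle' x hx⟩ ⟨h, hh, hle, rfl⟩

/-- The convex minorant `h` is needed because the supremum over an empty set of minorants would be
the default value `0`. -/
theorem gcm_le (hh : ConvexOn ℝ s h) (hle : ∀ t ∈ s, h t ≤ F t) (hx : x ∈ s) :
    gcm s F x ≤ F x :=
  csSup_le ⟨h x, h, hh, hle, rfl⟩ (by rintro _ ⟨h', -, hle', rfl⟩; exact hle' x hx)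

theorem convexOn_gcm (hh : ConvexOn ℝ s h) (hle : ∀ t ∈ s, h t ≤ F t) :
    ConvexOn ℝ s (gcm s F) := by
  refine ⟨hh.1, fun x hx y hy α β hα hβ hαβ => ?_⟩
  refine csSup_le ⟨_, h, hh, hle, rfl⟩ ?_
  rintro _ ⟨h', hc', hle', rfl⟩
  refine (hc'.2 hx hy hα hβ hαβ).trans ?_
  simp only [smul_eq_mul]
  gcongr
  · exact le_gcm hc' hle' hx
  · exact le_gcm hc' hle' hy

end gcm

/-! ### Primitives of continuous functions -/

section primitive

variable {f : ℝ → ℝ} {τ : ℝ}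

theorem intervalIntegrable_of_continuousOn_Icc_zero (hτ : 0 ≤ τ)
    (hc : ContinuousOn f (Set.Icc 0 τ)) : IntervalIntegrable f volume 0 τ :=
  ContinuousOn.intervalIntegrable (by rwa [Set.uIcc_of_le hτ])

theorem continuousOn_primitive_Icc_zero (hτ : 0 ≤ τ) (hc : ContinuousOn f (Set.Icc 0 τ)) :
    ContinuousOn (fun x => ∫ u in (0 : ℝ)..x, f u) (Set.Icc 0 τ) := by
  have := intervalIntegral.continuousOn_primitive_interval'
    (intervalIntegrable_of_continuousOn_Icc_zero hτ hc) (a := 0) (by simp)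
  rwa [Set.uIcc_of_le hτ] at this

theorem hasDerivAt_primitive_of_mem_Ioo (hc : ContinuousOn f (Set.Icc 0 τ)) {x : ℝ}
    (hx : x ∈ Set.Ioo 0 τ) : HasDerivAt (fun x => ∫ u in (0 : ℝ)..x, f u) (f x) x :=
  intervalIntegral.integral_hasDerivAt_right
    (intervalIntegrable_of_continuousOn_Icc_zero hx.1.le
      (hc.mono (Set.Icc_subset_Icc_right hx.2.le)))
    ((hc.mono Set.Ioo_subset_Icc_self).stronglyMeasurableAtFilter isOpen_Ioo x hx)
    (hc.continuousAt (Icc_mem_nhds hx.1 hx.2))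

theorem convexOn_primitive (hτ : 0 ≤ τ) (hf : MonotoneOn f (Set.Icc 0 τ))
    (hc : ContinuousOn f (Set.Icc 0 τ)) :
    ConvexOn ℝ (Set.Icc 0 τ) (fun x => ∫ u in (0 : ℝ)..x, f u) := by
  refine MonotoneOn.convexOn_of_deriv (convex_Icc _ _) (continuousOn_primitive_Icc_zero hτ hc) ?_ ?_
  · rw [interior_Icc]
    exact fun x hx =>
      (hasDerivAt_primitive_of_mem_Ioo hc hx).differentiableAt.differentiableWithinAt
  · rw [interior_Icc]
    intro x hx y hy hxy
    rw [(hasDerivAt_primitive_of_mem_Ioo hc hx).deriv,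
      (hasDerivAt_primitive_of_mem_Ioo hc hy).deriv]
    exact hf (Set.Ioo_subset_Icc_self hx) (Set.Ioo_subset_Icc_self hy) hxy

theorem monotoneOn_primitive (hf0 : ∀ x, 0 ≤ f x) (hc : ContinuousOn f (Set.Icc 0 τ)) :
    MonotoneOn (fun x => ∫ u in (0 : ℝ)..x, f u) (Set.Icc 0 τ) := fun _ hx _ hy hxy =>
  intervalIntegral.integral_mono_interval le_rfl hx.1 hxy (Eventually.of_forall hf0)
    (intervalIntegrable_of_continuousOn_Icc_zero hy.1 (hc.mono (Set.Icc_subset_Icc_right hy.2)))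

/-- The cumulative hazard of a distribution with density `f`: the quotient of the density and the
survival function integrates to minus the logarithm of the survival function. -/
theorem integral_div_one_sub_primitive (hτ : 0 ≤ τ) (hc : ContinuousOn f (Set.Icc 0 τ))
    (hpos : ∀ x ∈ Set.Icc 0 τ, 0 < 1 - ∫ u in (0 : ℝ)..x, f u) :
    ∫ x in (0 : ℝ)..τ, f x / (1 - ∫ u in (0 : ℝ)..x, f u)
      = -Real.log (1 - ∫ u in (0 : ℝ)..τ, f u) := by
  have hS : ContinuousOn (fun x => 1 - ∫ u in (0 : ℝ)..x, f u) (Set.Icc 0 τ) :=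
    continuousOn_const.sub (continuousOn_primitive_Icc_zero hτ hc)
  rw [intervalIntegral.integral_eq_sub_of_hasDerivAt_of_le hτ
    (f := fun x => -Real.log (1 - ∫ u in (0 : ℝ)..x, f u))]
  · simp
  · exact (hS.log fun x hx => (hpos x hx).ne').neg
  · intro x hx
    have := (((hasDerivAt_primitive_of_mem_Ioo hc hx).const_sub 1).log
      (hpos x (Set.Ioo_subset_Icc_self hx)).ne').fun_neg
    rwa [neg_div, neg_neg] at this
  · exact intervalIntegrable_of_continuousOn_Icc_zero hτ
      (hc.div hS fun x hx => (hpos x hx).ne')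

end primitive

/-! ### Convergence of minorants and of their slopes -/

/-- If monotone functions converge to a convex continuous function `F` uniformly on `[0, t]` for all
`t < τ`, then so do their greatest convex minorants on `[0, τ]`. Nothing is assumed near `τ`: there,
monotonicity and the continuity of `F` keep `F - δ` a minorant. -/
theorem tendstoUniformlyOn_gcm {G : ℕ → ℝ → ℝ} {F : ℝ → ℝ} {τ : ℝ} (hτ : 0 < τ)
    (hFconv : ConvexOn ℝ (Set.Icc 0 τ) F) (hFmono : MonotoneOn F (Set.Icc 0 τ))
    (hFcont : ContinuousOn F (Set.Icc 0 τ)) (hG : ∀ n, MonotoneOn (G n) (Set.Icc 0 τ))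
    (hlim : ∀ t, 0 < t → t < τ → TendstoUniformlyOn G F atTop (Set.Icc 0 t))
    {t : ℝ} (ht : t < τ) :
    TendstoUniformlyOn (fun n => gcm (Set.Icc 0 τ) (G n)) F atTop (Set.Icc 0 t) := by
  rw [Metric.tendstoUniformlyOn_iff]
  intro δ hδ
  -- the uniform convergence is used up to a point `t'` beyond which `F` grows by less than `δ / 3`
  obtain ⟨t', ht'0, htt', ht'τ, hFt'⟩ : ∃ t', 0 < t' ∧ t ≤ t' ∧ t' < τ ∧ F τ - F t' < δ / 3 := by
    have h1 : Tendsto F (𝓝[<] τ) (𝓝 (F τ)) :=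
      (hFcont τ (Set.right_mem_Icc.2 hτ.le)).mono_of_mem_nhdsWithin (Icc_mem_nhdsLT hτ)
    have h2 : ∀ᶠ y in 𝓝[<] τ, F τ - δ / 3 < F y := h1.eventually_const_lt (by linarith)
    have h3 : ∀ᶠ y in 𝓝[<] τ, y ∈ Set.Ioo (max t 0) τ := Ioo_mem_nhdsLT (max_lt ht hτ)
    obtain ⟨y, hy1, hy2⟩ := (h2.and h3).exists
    exact ⟨y, (le_max_right _ _).trans_lt hy2.1, ((le_max_left _ _).trans_lt hy2.1).le, hy2.2,
      by linarith⟩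
  filter_upwards [Metric.tendstoUniformlyOn_iff.1 (hlim t' ht'0 ht'τ) (δ / 3) (by linarith)]
    with n hn x hx
  have hxτ : x ∈ Set.Icc 0 τ := ⟨hx.1, hx.2.trans ht.le⟩
  -- `F - 2 δ / 3` is a convex minorant: up to `t'` by the uniform convergence, and beyond `t'`
  -- because `G n` increases while `F` gains less than `δ / 3`
  have hconv : ConvexOn ℝ (Set.Icc 0 τ) (fun y => F y + -(2 * δ / 3)) := hFconv.add_const _
  have hle : ∀ y ∈ Set.Icc 0 τ, (fun y => F y + -(2 * δ / 3)) y ≤ G n y := by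
    intro y hy
    have ht'm : t' ∈ Set.Icc 0 τ := ⟨ht'0.le, ht'τ.le⟩
    rcases le_total y t' with hyt | hyt
    · have := hn y ⟨hy.1, hyt⟩
      rw [Real.dist_eq, abs_lt] at this
      dsimp only; linarith
    · have h1 := hn t' ⟨ht'0.le, le_rfl⟩
      rw [Real.dist_eq, abs_lt] at h1
      have h2 := hG n ht'm hy hyt
      have h3 := hFmono hy (Set.right_mem_Icc.2 hτ.le) hy.2
      dsimp only; linarith
  have h1 := le_gcm hconv hle hxτ
  have h2 := gcm_le hconv hle hxτ
  have h3 := hn x ⟨hx.1, hx.2.trans htt'⟩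
  rw [Real.dist_eq, abs_lt] at *
  constructor <;> linarith

theorem integral_le_of_monotoneOn {f : ℝ → ℝ} {a c : ℝ} (hac : a ≤ c)
    (hf : MonotoneOn f (Set.Icc a c)) : ∫ u in a..c, f u ≤ (c - a) * f c := by
  have hi : IntervalIntegrable f volume a c :=
    MonotoneOn.intervalIntegrable (by rwa [Set.uIcc_of_le hac])
  have := intervalIntegral.integral_mono_on hac hi intervalIntegrable_const
    (g := fun _ => f c) fun x hx => hf hx (Set.right_mem_Icc.2 hac) hx.2
  simpa using this

theorem le_integral_of_monotoneOn {f : ℝ → ℝ} {a c : ℝ} (hac : a ≤ c)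
    (hf : MonotoneOn f (Set.Icc a c)) : (c - a) * f a ≤ ∫ u in a..c, f u := by
  have hi : IntervalIntegrable f volume a c :=
    MonotoneOn.intervalIntegrable (by rwa [Set.uIcc_of_le hac])
  have := intervalIntegral.integral_mono_on hac intervalIntegrable_const hi
    (f := fun _ => f a) fun x hx => hf (Set.left_mem_Icc.2 hac) hx hx.1
  simpa using this

/-- The left derivative of a convex function lies between its difference quotients on either side.
Those of `g n` converge to difference quotients of the primitive of `f`, which the monotone function
`f` controls. -/
theorem tendstoUniformlyOn_leftDeriv {g : ℕ → ℝ → ℝ} {f : ℝ → ℝ} {τ : ℝ}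
    (hfm : MonotoneOn f (Set.Icc 0 τ)) (hfc : ContinuousOn f (Set.Icc 0 τ))
    (hg : ∀ n, ConvexOn ℝ (Set.Icc 0 τ) (g n))
    (hlim : ∀ t, t < τ →
      TendstoUniformlyOn g (fun x => ∫ u in (0 : ℝ)..x, f u) atTop (Set.Icc 0 t))
    {s t : ℝ} (hs : 0 < s) (ht : t < τ) :
    TendstoUniformlyOn (fun n x => derivWithin (g n) (Set.Iio x) x) f atTop (Set.Icc s t) := by
  rw [Metric.tendstoUniformlyOn_iff]
  intro δ hδ
  have huc := isCompact_Icc.uniformContinuousOn_of_continuous hfc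
  rw [Metric.uniformContinuousOn_iff] at huc
  obtain ⟨η, hη, huc⟩ := huc (δ / 2) (half_pos hδ)
  obtain ⟨h, hh0, hh⟩ := exists_between (lt_min hη (lt_min hs (sub_pos.2 ht)))
  have hhη : h < η := hh.trans_le (min_le_left _ _)
  have hhs : h < s := hh.trans_le ((min_le_right _ _).trans (min_le_left _ _))
  have hht : h < τ - t := hh.trans_le ((min_le_right _ _).trans (min_le_right _ _))
  filter_upwards [Metric.tendstoUniformlyOn_iff.1 (hlim (t + h) (by linarith)) (δ * h / 8)
    (by positivity)] with n hn x hx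
  have hx1 := hx.1
  have hx2 := hx.2
  have m0 : x ∈ Set.Icc 0 τ := ⟨by linarith, by linarith⟩
  have m1 : x - h ∈ Set.Icc 0 τ := ⟨by linarith, by linarith⟩
  have m2 : x + h ∈ Set.Icc 0 τ := ⟨by linarith, by linarith⟩
  have mi : x ∈ interior (Set.Icc 0 τ) := by rw [interior_Icc]; constructor <;> linarith
  have hii : ∀ y ∈ Set.Icc 0 τ, IntervalIntegrable f volume 0 y := fun y hy =>
    ContinuousOn.intervalIntegrable
      (by rw [Set.uIcc_of_le hy.1]; exact hfc.mono (Set.Icc_subset_Icc_right hy.2))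
  have e0 := hn x ⟨m0.1, by linarith⟩
  have e1 := hn (x - h) ⟨m1.1, by linarith⟩
  have e2 := hn (x + h) ⟨m2.1, by linarith⟩
  have u1 := huc x m0 (x - h) m1 (by rw [Real.dist_eq, abs_lt]; constructor <;> linarith)
  have u2 := huc x m0 (x + h) m2 (by rw [Real.dist_eq, abs_lt]; constructor <;> linarith)
  have i1 := le_integral_of_monotoneOn (f := f) (a := x - h) (c := x) (by linarith)
    (hfm.mono (Set.Icc_subset_Icc m1.1 m0.2))
  have i2 := integral_le_of_monotoneOn (f := f) (a := x) (c := x + h) (by linarith)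
    (hfm.mono (Set.Icc_subset_Icc m0.1 m2.2))
  rw [← intervalIntegral.integral_interval_sub_left (hii _ m0) (hii _ m1)] at i1
  rw [← intervalIntegral.integral_interval_sub_left (hii _ m2) (hii _ m0)] at i2
  have d1 := (hg n).slope_le_leftDeriv_of_mem_interior m1 mi (by linarith)
  have d2 := ((hg n).leftDeriv_le_rightDeriv_of_mem_interior mi).trans
    ((hg n).rightDeriv_le_slope_of_mem_interior mi m2 (by linarith))
  rw [slope_def_field, div_le_iff₀ (by linarith)] at d1
  rw [slope_def_field, le_div_iff₀ (by linarith)] at d2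
  rw [Real.dist_eq, abs_lt] at *
  set D := derivWithin (g n) (Set.Iio x) x
  have v1 : (f x - D) * h < δ * h := by nlinarith
  have v2 : (D - f x) * h < δ * h := by nlinarith
  have w1 := lt_of_mul_lt_mul_right v1 hh0.le
  have w2 := lt_of_mul_lt_mul_right v2 hh0.le
  constructor <;> linarith

/-! ### Kernel smoothing -/

theorem IsStandardKernel.integrable {k : ℝ → ℝ} (hk : IsStandardKernel k) : Integrable k := by
  by_contra h
  have := hk.integral_eq_one
  rw [integral_undef h] at this
  exact zero_ne_one this

theorem IsStandardKernel.integrable_scaledKernel {k : ℝ → ℝ} (hk : IsStandardKernel k) {b : ℝ}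
    (hb : 0 < b) (x : ℝ) : Integrable (fun u => scaledKernel k b (x - u)) :=
  ((hk.integrable.comp_div hb.ne').comp_sub_left x).const_mul (1 / b)

theorem IsStandardKernel.integral_scaledKernel {k : ℝ → ℝ} (hk : IsStandardKernel k) {b : ℝ}
    (hb : 0 < b) (x : ℝ) : ∫ u in (x - b)..(x + b), scaledKernel k b (x - u) = 1 := by
  have h1 : ∫ v in (-1 : ℝ)..1, k v = 1 := by
    rw [intervalIntegral.integral_of_le (by norm_num), ← integral_Icc_eq_integral_Ioc,
      setIntegral_eq_integral_of_forall_compl_eq_zero, hk.integral_eq_one]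
    intro v hv
    by_contra h
    exact hv (hk.support_subset h)
  have h2 := intervalIntegral.integral_comp_sub_left (a := x - b) (b := x + b)
    (fun v => scaledKernel k b v) x
  rw [h2]
  simp only [scaledKernel, intervalIntegral.integral_const_mul]
  rw [intervalIntegral.integral_comp_div _ hb.ne']
  have e1 : (x - (x + b)) / b = -1 := by field_simp; ring
  have e2 : (x - (x - b)) / b = 1 := by field_simp; ring
  rw [e1, e2, h1]
  simp [hb.ne']

/-- Smoothing is averaging: a function that stays within `δ` of `y` on the window keeps this property
after smoothing. -/
theorem abs_integral_scaledKernel_mul_sub_le {k : ℝ → ℝ} (hk : IsStandardKernel k) {b : ℝ}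
    (hb : 0 < b) {γ : ℝ → ℝ} {x y δ : ℝ} (hγm : MonotoneOn γ (Set.Icc (x - b) (x + b)))
    (hγ : ∀ u ∈ Set.Icc (x - b) (x + b), |γ u - y| ≤ δ) :
    |(∫ u in (x - b)..(x + b), scaledKernel k b (x - u) * γ u) - y| ≤ δ := by
  have hab : x - b ≤ x + b := by linarith
  have hki : IntervalIntegrable (fun u => scaledKernel k b (x - u)) volume (x - b) (x + b) :=
    (hk.integrable_scaledKernel hb x).intervalIntegrable
  have hkγ : IntervalIntegrable (fun u => scaledKernel k b (x - u) * γ u) volume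
      (x - b) (x + b) := by
    rw [intervalIntegrable_iff_integrableOn_Icc_of_le hab] at hki ⊢
    refine Integrable.mul_bdd (c := |y| + δ) hki
      (aemeasurable_restrict_of_monotoneOn measurableSet_Icc hγm).aestronglyMeasurable ?_
    filter_upwards [ae_restrict_mem measurableSet_Icc] with u hu
    have := hγ u hu
    rw [Real.norm_eq_abs]
    calc |γ u| = |y + (γ u - y)| := by ring_nf
      _ ≤ |y| + |γ u - y| := abs_add_le _ _
      _ ≤ |y| + δ := by linarith
  have h1 : (∫ u in (x - b)..(x + b), scaledKernel k b (x - u) * γ u) - y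
      = ∫ u in (x - b)..(x + b), scaledKernel k b (x - u) * (γ u - y) := by
    simp only [mul_sub]
    rw [intervalIntegral.integral_sub hkγ (hki.mul_const y), intervalIntegral.integral_mul_const,
      hk.integral_scaledKernel hb, one_mul]
  have h2 : ∫ u in (x - b)..(x + b), scaledKernel k b (x - u) * δ = δ := by
    rw [intervalIntegral.integral_mul_const, hk.integral_scaledKernel hb, one_mul]
  rw [h1, ← Real.norm_eq_abs]
  refine (intervalIntegral.norm_integral_le_of_norm_le hab (Filter.Eventually.of_forall ?_)
    (hki.mul_const δ)).trans h2.le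
  intro u hu
  have hk0 : 0 ≤ scaledKernel k b (x - u) := mul_nonneg (by positivity) (hk.nonneg _)
  rw [norm_mul, Real.norm_eq_abs, Real.norm_eq_abs, abs_of_nonneg hk0]
  exact mul_le_mul_of_nonneg_left (hγ u (Set.Ioc_subset_Icc_self hu)) hk0

/-- Interior consistency of kernel smoothing. Once the bandwidth is below `ε / 2`, the truncation of the
window to `[0, τ]` has no effect, and the window stays in the region of uniform convergence. -/
theorem tendsto_iSup_smoothing {k : ℝ → ℝ} (hk : IsStandardKernel k) {b : ℕ → ℝ}
    (hb_pos : ∀ n, 1 ≤ n → 0 < b n) (hb_zero : Tendsto b atTop (𝓝 0))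
    {γ : ℕ → ℝ → ℝ} {f : ℝ → ℝ} {τ ε : ℝ} (hε : 0 < ε)
    (hf : ContinuousOn f (Set.Icc 0 τ)) (hγm : ∀ n, MonotoneOn (γ n) (Set.Ioo 0 τ))
    (hγ : ∀ s t, 0 < s → t < τ → TendstoUniformlyOn γ f atTop (Set.Icc s t)) :
    Tendsto (fun n => ⨆ x ∈ Set.Icc ε (τ - ε), ENNReal.ofReal
      |(∫ u in (max (x - b n) 0)..(min (x + b n) τ), scaledKernel k (b n) (x - u) * γ n u) - f x|)
      atTop (𝓝 0) := by
  rw [ENNReal.tendsto_atTop_zero]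
  intro δ' hδ'
  rcases eq_or_ne δ' ⊤ with rfl | hδt
  · exact ⟨0, fun n _ => le_top⟩
  have hδ : 0 < δ'.toReal := ENNReal.toReal_pos hδ'.ne' hδt
  set δ := δ'.toReal
  have huc := isCompact_Icc.uniformContinuousOn_of_continuous hf
  rw [Metric.uniformContinuousOn_iff] at huc
  obtain ⟨η, hη, huc⟩ := huc (δ / 2) (half_pos hδ)
  have hbs : ∀ᶠ n in atTop, b n < min η (ε / 2) :=
    hb_zero.eventually_lt_const (lt_min hη (half_pos hε))
  have hγ' := Metric.tendstoUniformlyOn_iff.1 (hγ (ε / 2) (τ - ε / 2) (half_pos hε) (by linarith))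
    (δ / 2) (half_pos hδ)
  rw [← eventually_atTop]
  filter_upwards [hbs, hγ', eventually_ge_atTop 1] with n hbn hγn hn1
  have hb0 := hb_pos n hn1
  have hbη := hbn.trans_le (min_le_left _ _)
  have hbε := hbn.trans_le (min_le_right _ _)
  refine iSup₂_le fun x hx => ?_
  have hx1 := hx.1
  have hx2 := hx.2
  rw [max_eq_left (by linarith), min_eq_left (by linarith)]
  refine ENNReal.ofReal_le_of_le_toReal ?_
  refine abs_integral_scaledKernel_mul_sub_le hk hb0 ((hγm n).mono ?_) fun u hu => ?_
  · intro u hu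
    constructor <;> linarith [hu.1, hu.2]
  · have hu1 := hu.1
    have hu2 := hu.2
    have h1 := hγn u ⟨by linarith, by linarith⟩
    have h2 := huc u ⟨by linarith, by linarith⟩ x ⟨by linarith, by linarith⟩
      (by rw [Real.dist_eq, abs_lt]; constructor <;> linarith)
    rw [Real.dist_eq, abs_lt] at *
    rw [abs_le]
    constructor <;> linarith

/-! ### Kaplan-Meier and Nelson-Aalen estimators -/

section KaplanMeier

variable {n : ℕ} {T Δ : Fin n → ℝ}

theorem deaths_nonneg (hΔ : ∀ i, 0 ≤ Δ i) (s : ℝ) : 0 ≤ deaths T Δ s :=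
  Finset.sum_nonneg fun i _ => by split_ifs <;> simp [hΔ]

theorem atRisk_nonneg (s : ℝ) : 0 ≤ atRisk T s :=
  Finset.sum_nonneg fun i _ => by split_ifs <;> simp

theorem antitone_atRisk : Antitone (atRisk T) := fun s t hst =>
  Finset.sum_le_sum fun i _ => by
    split_ifs with h1 h2
    · exact le_rfl
    · exact absurd (hst.trans h1) h2
    · exact zero_le_one
    · exact le_rfl

theorem deaths_le_atRisk (hΔ' : ∀ i, Δ i ≤ 1) (s : ℝ) : deaths T Δ s ≤ atRisk T s :=
  Finset.sum_le_sum fun i _ => by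
    split_ifs with h1 h2 h2
    · exact hΔ' i
    · exact absurd h1.ge h2
    · exact zero_le_one
    · exact le_rfl

theorem hazard_nonneg (hΔ : ∀ i, 0 ≤ Δ i) (s : ℝ) : 0 ≤ deaths T Δ s / atRisk T s :=
  div_nonneg (deaths_nonneg hΔ s) (atRisk_nonneg s)

theorem hazard_le_one (hΔ' : ∀ i, Δ i ≤ 1) (s : ℝ) : deaths T Δ s / atRisk T s ≤ 1 :=
  div_le_one_of_le₀ (deaths_le_atRisk hΔ' s) (atRisk_nonneg s)

theorem monotone_kaplanMeier (hΔ : ∀ i, 0 ≤ Δ i) (hΔ' : ∀ i, Δ i ≤ 1) :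
    Monotone (kaplanMeier T Δ) := by
  intro s t hst
  have hsub : (Finset.univ.image T).filter (· ≤ s) ⊆ (Finset.univ.image T).filter (· ≤ t) :=
    Finset.monotone_filter_right _ fun x _ hx => le_trans hx hst
  have h0 : ∀ x : ℝ, 0 ≤ 1 - deaths T Δ x / atRisk T x := fun x =>
    sub_nonneg.2 (hazard_le_one hΔ' x)
  have h1 : ∀ x : ℝ, 1 - deaths T Δ x / atRisk T x ≤ 1 := fun x =>
    sub_le_self _ (hazard_nonneg hΔ x)
  simp only [kaplanMeier]
  rw [← Finset.prod_sdiff hsub]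
  refine sub_le_sub_left (mul_le_of_le_one_left (Finset.prod_nonneg fun x _ => h0 x) ?_) 1
  exact Finset.prod_le_one (fun x _ => h0 x) fun x _ => h1 x

/-- The telescoping bound for the difference of two products of numbers in `[0, 1]`. -/
theorem abs_prod_sub_prod_le_sum {ι : Type*} (s : Finset ι) {u v : ι → ℝ}
    (hu0 : ∀ i, 0 ≤ u i) (hu1 : ∀ i, u i ≤ 1) (hv0 : ∀ i, 0 ≤ v i) (hv1 : ∀ i, v i ≤ 1) :
    |∏ i ∈ s, u i - ∏ i ∈ s, v i| ≤ ∑ i ∈ s, |u i - v i| := by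
  classical
  induction s using Finset.induction_on with
  | empty => simp
  | insert a s ha ih =>
    rw [Finset.prod_insert ha, Finset.prod_insert ha, Finset.sum_insert ha]
    have e : u a * ∏ i ∈ s, u i - v a * ∏ i ∈ s, v i
        = (u a - v a) * ∏ i ∈ s, u i + v a * (∏ i ∈ s, u i - ∏ i ∈ s, v i) := by ring
    rw [e]
    refine (abs_add_le _ _).trans (add_le_add ?_ ?_)
    · rw [abs_mul, abs_of_nonneg (Finset.prod_nonneg fun i _ => hu0 i)]
      exact mul_le_of_le_one_right (abs_nonneg _)
        (Finset.prod_le_one (fun i _ => hu0 i) fun i _ => hu1 i)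
    · rw [abs_mul, abs_of_nonneg (hv0 a)]
      exact (mul_le_of_le_one_left (abs_nonneg _) (hv1 a)).trans ih

/-- The Nelson-Aalen estimator of the cumulative hazard, as a sum over the observations. -/
noncomputable def nelsonAalen {n : ℕ} (T Δ : Fin n → ℝ) (t : ℝ) : ℝ :=
  ∑ i, (if T i ≤ t then Δ i else 0) / atRisk T (T i)

theorem sum_hazard_eq_nelsonAalen (t : ℝ) :
    ∑ s ∈ (Finset.univ.image T).filter (· ≤ t), deaths T Δ s / atRisk T s
      = nelsonAalen T Δ t := by
  simp only [deaths, nelsonAalen, Finset.sum_div]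
  rw [Finset.sum_comm]
  refine Finset.sum_congr rfl fun i _ => ?_
  simp only [ite_div, zero_div]
  rw [Finset.sum_ite_eq]
  simp

/-- Without tied deaths, the survival curve of the product limit estimator is close to the exponential
of minus the Nelson-Aalen estimator: at most `n` factors `1 - x` are replaced by `exp (-x)`, each at
a cost of `x ^ 2`, where `x` is at most one over the number at risk at time `t`. -/
theorem abs_kaplanMeier_sub_le (hΔ : ∀ i, 0 ≤ Δ i) (hΔ' : ∀ i, Δ i ≤ 1)
    (hd : ∀ s, deaths T Δ s ≤ 1) {t : ℝ} (ht : 0 < atRisk T t) :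
    |kaplanMeier T Δ t - (1 - Real.exp (-nelsonAalen T Δ t))| ≤ n * (1 / atRisk T t) ^ 2 := by
  have h0 := hazard_nonneg (T := T) hΔ
  have h1 := hazard_le_one (T := T) hΔ'
  rw [← sum_hazard_eq_nelsonAalen, ← Finset.sum_neg_distrib, Real.exp_sum, kaplanMeier,
    sub_sub_sub_cancel_left, abs_sub_comm]
  refine (abs_prod_sub_prod_le_sum _ (fun s => sub_nonneg.2 (h1 s))
    (fun s => sub_le_self _ (h0 s)) (fun s => (Real.exp_pos _).le)
    (fun s => Real.exp_le_one_iff.2 (neg_nonpos.2 (h0 s)))).trans ?_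
  have hterm : ∀ s ∈ (Finset.univ.image T).filter (· ≤ t),
      |1 - deaths T Δ s / atRisk T s - Real.exp (-(deaths T Δ s / atRisk T s))|
        ≤ (1 / atRisk T t) ^ 2 := by
    intro s hs
    have hst : s ≤ t := (Finset.mem_filter.1 hs).2
    have e := Real.abs_exp_sub_one_sub_id_le (x := -(deaths T Δ s / atRisk T s))
      (by rw [abs_neg, abs_of_nonneg (h0 s)]; exact h1 s)
    rw [abs_sub_comm]
    have e2 : Real.exp (-(deaths T Δ s / atRisk T s)) - (1 - deaths T Δ s / atRisk T s)
      = Real.exp (-(deaths T Δ s / atRisk T s)) - 1 - -(deaths T Δ s / atRisk T s) := by ring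
    rw [e2]
    refine e.trans ?_
    rw [neg_sq]
    exact pow_le_pow_left₀ (h0 s) (div_le_div₀ zero_le_one (hd s) ht (antitone_atRisk hst)) 2
  refine (Finset.sum_le_card_nsmul _ _ _ hterm).trans ?_
  rw [nsmul_eq_mul]
  gcongr
  refine (Finset.card_filter_le _ _).trans (Finset.card_image_le.trans ?_)
  simp

end KaplanMeier

/-! ### Averages with converging denominators -/

/-- In an average of `w i / R (T i)`, the denominators may be replaced by uniformly close ones, as
long as `R` is bounded away from zero. -/
theorem tendsto_sum_div_of_tendstoUniformlyOn {r : ℕ → ℝ → ℝ} {R : ℝ → ℝ} {S : Set ℝ} {c L : ℝ}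
    (hc : 0 < c) (hR : ∀ x ∈ S, c ≤ R x) (hr : TendstoUniformlyOn r R atTop S) {w T : ℕ → ℝ}
    (hw0 : ∀ i, 0 ≤ w i) (hw1 : ∀ i, w i ≤ 1) (hwT : ∀ i, w i ≠ 0 → T i ∈ S)
    (hL : Tendsto (fun n : ℕ => (∑ i ∈ Finset.range n, w i / R (T i)) / n) atTop (𝓝 L)) :
    Tendsto (fun n : ℕ => (∑ i ∈ Finset.range n, w i / r n (T i)) / n) atTop (𝓝 L) := by
  rw [tendsto_iff_of_dist (p := atTop) (f₂ := fun n : ℕ =>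
    (∑ i ∈ Finset.range n, w i / R (T i)) / n)]
  · exact hL
  rw [Metric.tendsto_nhds]
  intro δ hδ
  filter_upwards [Metric.tendstoUniformlyOn_iff.1 hr (min (c / 2) (δ / 2 * (c / 2 * c)))
    (by positivity), eventually_gt_atTop 0] with n hn hn0
  have hn0' : (0 : ℝ) < n := by exact_mod_cast hn0
  rw [Real.dist_eq, Real.dist_eq, sub_zero, abs_abs, ← sub_div, ← Finset.sum_sub_distrib, abs_div,
    abs_of_pos hn0']
  have hterm : ∀ i ∈ Finset.range n, |w i / r n (T i) - w i / R (T i)| ≤ δ / 2 := by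
    intro i _
    by_cases hwi : w i = 0
    · simp [hwi]; positivity
    have hx := hwT i hwi
    have h1 := hn _ hx
    have hRx := hR _ hx
    rw [Real.dist_eq] at h1
    have h2 := h1.trans_le (min_le_left _ _)
    have h3 := h1.trans_le (min_le_right _ _)
    rw [abs_lt] at h2
    have hrx : c / 2 ≤ r n (T i) := by linarith
    have hrpos : 0 < r n (T i) := by linarith
    have hRpos : 0 < R (T i) := by linarith
    have e : w i / r n (T i) - w i / R (T i)
        = w i * ((R (T i) - r n (T i)) / (r n (T i) * R (T i))) := by
      field_simp
    rw [e, abs_mul, abs_of_nonneg (hw0 i)]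
    refine (mul_le_of_le_one_left (abs_nonneg _) (hw1 i)).trans ?_
    rw [abs_div, abs_of_pos (mul_pos hrpos hRpos), div_le_iff₀ (mul_pos hrpos hRpos)]
    refine h3.le.trans ?_
    gcongr
  have := Finset.abs_sum_le_sum_abs (fun i => w i / r n (T i) - w i / R (T i)) (Finset.range n)
  have h4 := Finset.sum_le_card_nsmul _ _ _ hterm
  rw [Finset.card_range, nsmul_eq_mul] at h4
  rw [div_lt_iff₀ hn0']
  nlinarith

/-! ### Survival functions -/

theorem continuous_measureReal_Ici (μ : Measure ℝ) [IsProbabilityMeasure μ]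
    [NullSingletonClass μ] : Continuous fun x => μ.real (Set.Ici x) := by
  have h := intervalIntegral.continuous_primitive (μ := μ) (f := fun _ => (1 : ℝ))
    (fun _ _ => intervalIntegrable_const) 0
  simp only [intervalIntegral.integral_const_of_cdf] at h
  have e : (fun x => μ.real (Set.Ici x))
      = fun x => 1 - μ.real (Set.Iic 0) - (μ.real (Set.Iic x) - μ.real (Set.Iic 0)) • (1 : ℝ) := by
    funext x
    have : μ.real (Set.Ici x) = 1 - μ.real (Set.Iic x) := by
      rw [← probReal_compl_eq_one_sub measurableSet_Iic, Set.compl_Iic]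
      exact measureReal_congr Ioi_ae_eq_Ici.symm
    simp [this]
  rw [e]
  exact continuous_const.sub h

theorem measureReal_Ici_pos_of_lt_endPoint {μ : Measure ℝ} [IsFiniteMeasure μ] {s : ℝ}
    (h : (s : EReal) < endPoint μ) : 0 < μ.real (Set.Ici s) := by
  rw [endPoint, lt_iSup_iff] at h
  obtain ⟨x, h⟩ := h
  rw [lt_iSup_iff] at h
  obtain ⟨hx, hsx⟩ := h
  have hsx' : s < x := by exact_mod_cast hsx
  exact ENNReal.toReal_pos
    ((Measure.mem_support_iff_forall x).1 hx _ (Ici_mem_nhds hsx')).ne' (measure_ne_top _ _)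

theorem integral_withDensity_ofReal {f : ℝ → ℝ} (hf : Measurable f) (hf0 : ∀ x, 0 ≤ f x)
    (φ : ℝ → ℝ) :
    ∫ x, φ x ∂(volume.withDensity fun x => ENNReal.ofReal (f x)) = ∫ x, f x * φ x := by
  rw [integral_withDensity_eq_integral_toReal_smul hf.ennreal_ofReal
    (Eventually.of_forall fun _ => ENNReal.ofReal_lt_top)]
  simp [ENNReal.toReal_ofReal, hf0]

theorem measureReal_Ici_withDensity {f : ℝ → ℝ} (hf : Measurable f) (hf0 : ∀ x, 0 ≤ f x)
    (hneg : ∀ x, x < 0 → f x = 0) {μ : Measure ℝ} [IsProbabilityMeasure μ]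
    (hμ : μ = volume.withDensity fun x => ENNReal.ofReal (f x)) {x : ℝ} (hx : 0 ≤ x) :
    μ.real (Set.Ici x) = 1 - ∫ u in (0 : ℝ)..x, f u := by
  have h1 : μ.real (Set.Iio x) = ∫ u in (0 : ℝ)..x, f u := by
    rw [← integral_indicator_one measurableSet_Iio, hμ, integral_withDensity_ofReal hf hf0,
      intervalIntegral.integral_of_le hx, ← integral_Ico_eq_integral_Ioc,
      ← integral_indicator measurableSet_Ico]
    refine integral_congr_ae (Eventually.of_forall fun u => ?_)
    by_cases h0 : u < 0
    · simp [Set.indicator, hneg u h0]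
    · simp [Set.indicator, not_lt.1 h0]
  rw [← h1, ← Set.compl_Iio, probReal_compl_eq_one_sub measurableSet_Iio]

/-! ### The censorship model -/

section Model

variable {Ω : Type*} [MeasurableSpace Ω] {P : Measure Ω}
  {X C : ℕ → Ω → ℝ} {f g : ℝ → ℝ}

theorem RandomCensorship.nullSingletonClass_survival (h : RandomCensorship P X C f g) :
    NullSingletonClass (P.map (X 0)) := by
  rw [h.law_survival]; infer_instance

theorem RandomCensorship.nullSingletonClass_censoring (h : RandomCensorship P X C f g) :
    NullSingletonClass (P.map (C 0)) := by
  rw [h.law_censoring]; infer_instance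

theorem RandomCensorship.measurable_pair (h : RandomCensorship P X C f g) (i : ℕ) :
    Measurable fun ω => (X i ω, C i ω) :=
  (h.measurable_survival i).prodMk (h.measurable_censoring i)

theorem RandomCensorship.identDistrib_survival (h : RandomCensorship P X C f g) (i : ℕ) :
    IdentDistrib (X i) (X 0) P P :=
  (h.identDistrib_pairs i).comp measurable_fst

theorem RandomCensorship.ae_nonneg (h : RandomCensorship P X C f g) :
    ∀ᵐ ω ∂P, ∀ i, 0 ≤ X i ω := by
  rw [ae_all_iff]
  intro i
  have h0 : ∀ᵐ x ∂(P.map (X 0)), x ∈ Set.Ici (0 : ℝ) := by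
    rw [h.law_survival, ae_withDensity_iff h.measurable_f.ennreal_ofReal]
    refine Eventually.of_forall fun x hx => ?_
    by_contra hx0
    exact hx (by simp [h.f_eq_zero x (not_le.1 hx0)])
  have h1 := ae_of_ae_map (h.measurable_survival 0).aemeasurable h0
  exact (h.identDistrib_survival i).symm.ae_snd (p := fun x => x ∈ Set.Ici (0 : ℝ))
    measurableSet_Ici h1

variable [IsProbabilityMeasure P]

theorem RandomCensorship.isProbabilityMeasure_survival (h : RandomCensorship P X C f g) :
    IsProbabilityMeasure (P.map (X 0)) :=
  Measure.isProbabilityMeasure_map (h.measurable_survival 0).aemeasurable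

theorem RandomCensorship.isProbabilityMeasure_censoring (h : RandomCensorship P X C f g) :
    IsProbabilityMeasure (P.map (C 0)) :=
  Measure.isProbabilityMeasure_map (h.measurable_censoring 0).aemeasurable

theorem RandomCensorship.map_pair (h : RandomCensorship P X C f g) :
    P.map (fun ω => (X 0 ω, C 0 ω)) = (P.map (X 0)).prod (P.map (C 0)) :=
  (indepFun_iff_map_prod_eq_prod_map_map (h.measurable_survival 0).aemeasurable
    (h.measurable_censoring 0).aemeasurable).1 h.indep_censoring

/-- The strong law of large numbers for functions of the pairs of survival and censoring times. -/
theorem RandomCensorship.ae_tendsto_average (h : RandomCensorship P X C f g) {φ : ℝ × ℝ → ℝ}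
    (hφ : Measurable φ) {B : ℝ} (hB : ∀ z, |φ z| ≤ B) :
    ∀ᵐ ω ∂P, Tendsto (fun n : ℕ => (∑ i ∈ Finset.range n, φ (X i ω, C i ω)) / n) atTop
      (𝓝 (∫ z, φ z ∂((P.map (X 0)).prod (P.map (C 0))))) := by
  have e : ∫ z, φ z ∂((P.map (X 0)).prod (P.map (C 0))) = P[fun ω => φ (X 0 ω, C 0 ω)] := by
    rw [← h.map_pair, integral_map (h.measurable_pair 0).aemeasurable hφ.aestronglyMeasurable]
  rw [e]
  refine strong_law_ae_real (fun i ω => φ (X i ω, C i ω)) ?_ ?_ ?_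
  · exact Integrable.of_bound (hφ.comp (h.measurable_pair 0)).aestronglyMeasurable B
      (Eventually.of_forall fun ω => hB _)
  · intro i j hij
    exact (h.indep_pairs.indepFun hij).comp hφ hφ
  · exact fun i => (h.identDistrib_pairs i).comp hφ

/-- Almost surely the survival times are pairwise distinct, since their law has no atoms. -/
theorem RandomCensorship.ae_injective (h : RandomCensorship P X C f g) :
    ∀ᵐ ω ∂P, ∀ i j, i ≠ j → X i ω ≠ X j ω := by
  simp only [ae_all_iff]
  intro i j hij
  have hind : IndepFun (X i) (X j) P :=
    (h.indep_pairs.indepFun hij).comp measurable_fst measurable_fst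
  have hmap := (indepFun_iff_map_prod_eq_prod_map_map (h.measurable_survival i).aemeasurable
    (h.measurable_survival j).aemeasurable).1 hind
  rw [(h.identDistrib_survival i).map_eq, (h.identDistrib_survival j).map_eq] at hmap
  have := h.isProbabilityMeasure_survival
  have := h.nullSingletonClass_survival
  have hd : ∀ᵐ z ∂((P.map (X 0)).prod (P.map (X 0))), z.1 ≠ z.2 := by
    refine (Measure.measure_prod_null
      (measurableSet_eq_fun measurable_fst measurable_snd).compl.compl).2 ?_
    refine Eventually.of_forall fun x => ?_
    simp
  rw [← hmap] at hd
  exact ae_of_ae_map ((h.measurable_survival i).prodMk (h.measurable_survival j)).aemeasurable hd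

end Model

/-! ### Consistency of the Kaplan-Meier estimator -/

theorem uncensored_nonneg {Ω : Type*} (X C : Ω → ℝ) (ω : Ω) : 0 ≤ uncensored X C ω := by
  rw [uncensored]; split_ifs <;> simp

theorem uncensored_le_one {Ω : Type*} (X C : Ω → ℝ) (ω : Ω) : uncensored X C ω ≤ 1 := by
  rw [uncensored]; split_ifs <;> simp

/-- Two deaths at the same time would be two equal survival times. -/
theorem deaths_le_one {Ω : Type*} {X C : ℕ → Ω → ℝ} {ω : Ω}
    (hinj : ∀ i j, i ≠ j → X i ω ≠ X j ω) (n : ℕ) (s : ℝ) :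
    deaths (fun i : Fin n => followUp (X i) (C i) ω)
      (fun i : Fin n => uncensored (X i) (C i) ω) s ≤ 1 := by
  simp only [deaths]
  -- an uncensored observation at time `s` has survival time `s`, so there is at most one
  by_cases h : ∃ i : Fin n, X i ω = s
  · obtain ⟨i, hi⟩ := h
    rw [Finset.sum_eq_single i]
    · split_ifs
      · exact uncensored_le_one _ _ _
      · exact zero_le_one
    · intro j _ hji
      split_ifs with hj
      · rw [uncensored, if_neg]
        intro hjc
        rw [followUp, min_eq_left hjc, ← hi] at hj
        exact hinj j i (fun e => hji (Fin.ext e)) hj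
      · rfl
    · simp
  · rw [Finset.sum_eq_zero]
    · exact zero_le_one
    intro j _
    split_ifs with hj
    · rw [uncensored, if_neg]
      intro hjc
      rw [followUp, min_eq_left hjc] at hj
      exact h ⟨j, hj⟩
    · rfl

section Model

variable {Ω : Type*} [MeasurableSpace Ω] {P : Measure Ω}

/-- Almost sure pointwise convergence of random monotone functions to a continuous limit is almost
surely uniform on compact intervals. -/
theorem ae_tendstoUniformlyOn_of_monotoneOn {F : ℕ → Ω → ℝ → ℝ} {G : ℝ → ℝ} {a c : ℝ}
    (hac : a < c) (hF : ∀ n ω, MonotoneOn (F n ω) (Set.Icc a c)) (hG : ContinuousOn G (Set.Icc a c))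
    (hlim : ∀ x ∈ Set.Icc a c, ∀ᵐ ω ∂P, Tendsto (fun n => F n ω x) atTop (𝓝 (G x))) :
    ∀ᵐ ω ∂P, TendstoUniformlyOn (fun n => F n ω) G atTop (Set.Icc a c) := by
  have h : ∀ᵐ ω ∂P, ∀ q : ℚ, a + q * (c - a) ∈ Set.Icc a c →
      Tendsto (fun n => F n ω (a + q * (c - a))) atTop (𝓝 (G (a + q * (c - a)))) := by
    rw [ae_all_iff]
    intro q
    by_cases hq : a + q * (c - a) ∈ Set.Icc a c
    · filter_upwards [hlim _ hq] with ω hω _ using hω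
    · exact Eventually.of_forall fun ω hq' => absurd hq' hq
  filter_upwards [h] with ω hω
  exact tendstoUniformlyOn_of_monotoneOn_of_rat hac (fun n => hF n ω) hG hω

variable [IsProbabilityMeasure P] {X C : ℕ → Ω → ℝ} {f g : ℝ → ℝ}

/-- The probability that a subject is still at risk at time `s`, written as the product of the
survival functions of the independent survival and censoring times. -/
noncomputable def atRiskProb (P : Measure Ω) (X C : ℕ → Ω → ℝ) (s : ℝ) : ℝ :=
  (P.map (X 0)).real (Set.Ici s) * (P.map (C 0)).real (Set.Ici s)

theorem RandomCensorship.continuous_atRiskProb (h : RandomCensorship P X C f g) :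
    Continuous (atRiskProb P X C) := by
  have := h.isProbabilityMeasure_survival
  have := h.nullSingletonClass_survival
  have := h.isProbabilityMeasure_censoring
  have := h.nullSingletonClass_censoring
  exact (continuous_measureReal_Ici _).mul (continuous_measureReal_Ici _)

theorem RandomCensorship.antitone_atRiskProb (h : RandomCensorship P X C f g) :
    Antitone (atRiskProb P X C) := by
  have := h.isProbabilityMeasure_survival
  have := h.isProbabilityMeasure_censoring
  intro s t hst
  exact mul_le_mul (measureReal_mono (Set.Ici_subset_Ici.2 hst))
    (measureReal_mono (Set.Ici_subset_Ici.2 hst)) measureReal_nonneg measureReal_nonneg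

theorem RandomCensorship.ae_tendsto_atRisk (h : RandomCensorship P X C f g) (s : ℝ) :
    ∀ᵐ ω ∂P, Tendsto (fun n : ℕ => atRisk (fun i : Fin n => followUp (X i) (C i) ω) s / n) atTop
      (𝓝 (atRiskProb P X C s)) := by
  have := h.isProbabilityMeasure_survival
  have := h.isProbabilityMeasure_censoring
  have hs : MeasurableSet (Set.Ici s ×ˢ Set.Ici s : Set (ℝ × ℝ)) :=
    measurableSet_Ici.prod measurableSet_Ici
  have h1 := h.ae_tendsto_average (φ := (Set.Ici s ×ˢ Set.Ici s).indicator 1)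
    (measurable_one.indicator hs) (B := 1) fun z => by
      simp only [Set.indicator]; split_ifs <;> simp
  rw [integral_indicator_one hs, measureReal_prod_prod] at h1
  filter_upwards [h1] with ω hω
  refine hω.congr fun n => ?_
  rw [Finset.sum_range, atRisk]
  congr 1
  refine Finset.sum_congr rfl fun i _ => ?_
  simp [Set.indicator, followUp]

theorem RandomCensorship.ae_tendstoUniformlyOn_atRisk (h : RandomCensorship P X C f g) (t : ℝ) :
    ∀ᵐ ω ∂P, TendstoUniformlyOn
      (fun (n : ℕ) s => atRisk (fun i : Fin n => followUp (X i) (C i) ω) s / n)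
      (atRiskProb P X C) atTop (Set.Icc 0 t) := by
  have h1 := ae_tendstoUniformlyOn_of_monotoneOn (P := P) (a := 0) (c := max t 1)
    (F := fun n ω s => -(atRisk (fun i : Fin n => followUp (X i) (C i) ω) s / n))
    (G := fun s => -atRiskProb P X C s) (by simp)
    (fun n ω x _ y _ hxy => neg_le_neg
      (div_le_div_of_nonneg_right (antitone_atRisk hxy) n.cast_nonneg))
    h.continuous_atRiskProb.neg.continuousOn
    fun x _ => (h.ae_tendsto_atRisk x).mono fun ω hω => hω.neg
  filter_upwards [h1] with ω hω
  have := (hω.mono (Set.Icc_subset_Icc_right (le_max_left t 1))).neg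
  convert this using 1
  · funext n s; simp
  · funext s; simp

theorem RandomCensorship.atRiskProb_pos (h : RandomCensorship P X C f g) {s : ℝ}
    (hX : (s : EReal) < endPoint (P.map (X 0))) (hC : (s : EReal) < endPoint (P.map (C 0))) :
    0 < atRiskProb P X C s := by
  have := h.isProbabilityMeasure_survival
  have := h.isProbabilityMeasure_censoring
  exact mul_pos (measureReal_Ici_pos_of_lt_endPoint hX) (measureReal_Ici_pos_of_lt_endPoint hC)

/-- The contribution of a subject with survival time `z.1` and censoring time `z.2` to the
Nelson-Aalen sum at time `t`, with the fraction at risk replaced by its limit. -/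
noncomputable def hazardScore (P : Measure Ω) (X C : ℕ → Ω → ℝ) (t : ℝ) (z : ℝ × ℝ) : ℝ :=
  if z.1 ≤ z.2 ∧ z.1 ≤ t then (atRiskProb P X C z.1)⁻¹ else 0

theorem RandomCensorship.measurable_hazardScore (h : RandomCensorship P X C f g) (t : ℝ) :
    Measurable (hazardScore P X C t) :=
  Measurable.ite ((measurableSet_le measurable_fst measurable_snd).inter
      (measurableSet_le measurable_fst measurable_const))
    (h.continuous_atRiskProb.measurable.comp measurable_fst).inv measurable_const

theorem RandomCensorship.abs_hazardScore_le (h : RandomCensorship P X C f g) {t : ℝ}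
    (hpos : 0 < atRiskProb P X C t) (z : ℝ × ℝ) :
    |hazardScore P X C t z| ≤ (atRiskProb P X C t)⁻¹ := by
  rw [hazardScore]
  split_ifs with hz
  · have h1 := h.antitone_atRiskProb hz.2
    rw [abs_of_pos (inv_pos.2 (hpos.trans_le h1))]
    exact inv_anti₀ hpos h1
  · rw [abs_zero]
    exact (inv_pos.2 hpos).le

/-- The mean hazard score is the cumulative hazard of the survival times: the survival function of
the censoring times cancels. -/
theorem RandomCensorship.integral_hazardScore (h : RandomCensorship P X C f g) {t : ℝ} (ht : 0 ≤ t)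
    (hc : ContinuousOn f (Set.Icc 0 t)) (hpos : 0 < atRiskProb P X C t) :
    ∫ z, hazardScore P X C t z ∂((P.map (X 0)).prod (P.map (C 0)))
      = -Real.log (1 - ∫ u in (0 : ℝ)..t, f u) := by
  have := h.isProbabilityMeasure_survival
  have := h.isProbabilityMeasure_censoring
  have hS : ∀ x, 0 ≤ x → (P.map (X 0)).real (Set.Ici x) = 1 - ∫ u in (0 : ℝ)..x, f u := fun x hx =>
    measureReal_Ici_withDensity h.measurable_f h.nonneg_f h.f_eq_zero h.law_survival hx
  have hpos' : ∀ x, x ≤ t → 0 < atRiskProb P X C x := fun x hx =>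
    hpos.trans_le (h.antitone_atRiskProb hx)
  have hSpos : ∀ x ∈ Set.Icc 0 t, 0 < 1 - ∫ u in (0 : ℝ)..x, f u := by
    intro x hx
    rw [← hS x hx.1]
    exact pos_of_mul_pos_left (hpos' x hx.2) measureReal_nonneg
  rw [integral_prod _ (Integrable.of_bound (h.measurable_hazardScore t).aestronglyMeasurable
    (atRiskProb P X C t)⁻¹ (Eventually.of_forall (h.abs_hazardScore_le hpos)))]
  -- the inner integral over the censoring time cancels the censoring factor of `atRiskProb`
  have hinner : ∀ x : ℝ,
      ∫ c, (if x ≤ c ∧ x ≤ t then (atRiskProb P X C x)⁻¹ else 0) ∂(P.map (C 0))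
      = (Set.Iic t).indicator (fun x => ((P.map (X 0)).real (Set.Ici x))⁻¹) x := by
    intro x
    by_cases hx : x ≤ t
    · have e : (fun c => if x ≤ c ∧ x ≤ t then (atRiskProb P X C x)⁻¹ else 0)
          = (Set.Ici x).indicator fun _ => (atRiskProb P X C x)⁻¹ := by
        funext c
        simp [Set.indicator, hx]
      rw [e, integral_indicator_const _ measurableSet_Ici, Set.indicator_of_mem (Set.mem_Iic.2 hx),
        smul_eq_mul]
      have h2 := (pos_of_mul_pos_right (hpos' x hx) measureReal_nonneg).ne'
      have h3 := (hpos' x hx).ne'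
      simp only [atRiskProb] at h3 ⊢
      rw [mul_inv, mul_left_comm, mul_inv_cancel₀ h2, mul_one]
    · simp [hx]
  simp only [hazardScore, hinner]
  rw [← integral_div_one_sub_primitive ht hc hSpos, intervalIntegral.integral_of_le ht,
    ← integral_Icc_eq_integral_Ioc, ← integral_indicator measurableSet_Icc]
  conv_lhs => rw [h.law_survival]
  rw [integral_withDensity_ofReal h.measurable_f h.nonneg_f]
  refine integral_congr_ae (Eventually.of_forall fun x => ?_)
  rcases lt_or_ge x 0 with hx0 | hx0
  · simp [h.f_eq_zero x hx0, hx0]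
  · by_cases hxt : x ≤ t
    · simp [← h.law_survival, Set.indicator, hx0, hxt, hS x hx0, div_eq_mul_inv]
    · simp [Set.indicator, hxt]

/-- Strong consistency of the Nelson-Aalen estimator for the cumulative hazard of the survival times. -/
theorem RandomCensorship.ae_tendsto_nelsonAalen (h : RandomCensorship P X C f g) {t : ℝ}
    (ht : 0 ≤ t) (hc : ContinuousOn f (Set.Icc 0 t)) (hpos : 0 < atRiskProb P X C t) :
    ∀ᵐ ω ∂P, Tendsto (fun n : ℕ => nelsonAalen (fun i : Fin n => followUp (X i) (C i) ω)
      (fun i : Fin n => uncensored (X i) (C i) ω) t) atTop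
      (𝓝 (-Real.log (1 - ∫ u in (0 : ℝ)..t, f u))) := by
  have h1 := h.ae_tendsto_average (h.measurable_hazardScore t) (h.abs_hazardScore_le hpos)
  rw [h.integral_hazardScore ht hc hpos] at h1
  filter_upwards [h1, h.ae_tendstoUniformlyOn_atRisk t, h.ae_nonneg] with ω hω hunif hnn
  set T : ℕ → ℝ := fun i => followUp (X i) (C i) ω with hT
  set w : ℕ → ℝ := fun i => if T i ≤ t then uncensored (X i) (C i) ω else 0 with hw
  -- for an uncensored subject the observed time is the survival time
  have hscore : ∀ i, hazardScore P X C t (X i ω, C i ω) = w i / atRiskProb P X C (T i) := by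
    intro i
    by_cases hi : X i ω ≤ C i ω
    · have hTi : T i = X i ω := min_eq_left hi
      by_cases hit : X i ω ≤ t <;> simp [hazardScore, hw, hTi, uncensored, hi, hit]
    · simp [hazardScore, hw, uncensored, hi]
  have h2 := tendsto_sum_div_of_tendstoUniformlyOn (w := w) (T := T) hpos
    (fun x hx => h.antitone_atRiskProb hx.2) hunif ?_ ?_ ?_
    (hω.congr fun n => by simp only [hscore])
  · refine h2.congr fun n => ?_
    rcases Nat.eq_zero_or_pos n with rfl | hn
    · simp [nelsonAalen]
    have hn' : (n : ℝ) ≠ 0 := by positivity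
    rw [Finset.sum_range, nelsonAalen, Finset.sum_div]
    refine Finset.sum_congr rfl fun i _ => ?_
    rw [div_div, div_mul_cancel₀ _ hn']
  · intro i
    simp only [hw]; split_ifs
    exacts [uncensored_nonneg _ _ _, le_rfl]
  · intro i
    simp only [hw]; split_ifs
    exacts [uncensored_le_one _ _ _, zero_le_one]
  · intro i hi
    by_cases hit : T i ≤ t
    · by_cases hXC : X i ω ≤ C i ω
      · refine ⟨?_, hit⟩
        simp only [hT, followUp, min_eq_left hXC]
        exact hnn i
      · simp [hw, uncensored, hXC] at hi
    · simp [hw, hit] at hi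

/-- Strong consistency of the Kaplan-Meier estimator at a time `t` which a subject reaches with
positive probability. -/
theorem RandomCensorship.ae_tendsto_kaplanMeier (h : RandomCensorship P X C f g) {t : ℝ}
    (ht : 0 ≤ t) (hc : ContinuousOn f (Set.Icc 0 t)) (hpos : 0 < atRiskProb P X C t) :
    ∀ᵐ ω ∂P, Tendsto (fun n : ℕ => kaplanMeier (fun i : Fin n => followUp (X i) (C i) ω)
      (fun i : Fin n => uncensored (X i) (C i) ω) t) atTop (𝓝 (∫ u in (0 : ℝ)..t, f u)) := by
  have := h.isProbabilityMeasure_survival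
  have hS : 0 < 1 - ∫ u in (0 : ℝ)..t, f u := by
    rw [← measureReal_Ici_withDensity h.measurable_f h.nonneg_f h.f_eq_zero h.law_survival ht]
    exact pos_of_mul_pos_left hpos measureReal_nonneg
  filter_upwards [h.ae_tendsto_nelsonAalen ht hc hpos, h.ae_tendsto_atRisk t, h.ae_injective]
    with ω hNA hrisk hinj
  have hexp := tendsto_const_nhds (x := (1 : ℝ)).sub (Real.continuous_exp.tendsto _ |>.comp hNA.neg)
  rw [neg_neg, Real.exp_log hS, sub_sub_cancel] at hexp
  refine (tendsto_iff_of_dist ?_).1 hexp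
  have hsmall := tendsto_one_div_atTop_nhds_zero_nat (𝕜 := ℝ) |>.mul ((hrisk.inv₀ hpos.ne').pow 2)
  rw [zero_mul] at hsmall
  refine squeeze_zero' (Eventually.of_forall fun n => dist_nonneg) ?_ hsmall
  filter_upwards [hrisk.eventually_const_lt hpos, eventually_gt_atTop 0] with n hn hn0
  have hn0' : (0 : ℝ) < n := by exact_mod_cast hn0
  have hr : 0 < atRisk (fun i : Fin n => followUp (X i) (C i) ω) t := by
    rwa [lt_div_iff₀ hn0', zero_mul] at hn
  rw [dist_comm, Real.dist_eq]
  refine (abs_kaplanMeier_sub_le (fun i => uncensored_nonneg _ _ _)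
    (fun i => uncensored_le_one _ _ _) (deaths_le_one hinj n) hr).trans (le_of_eq ?_)
  field_simp

end Model

end SmoothedGrenander

/-! ### Uniform consistency of the smoothed estimator -/

open SmoothedGrenander in
theorem mainTheorem7 {Ω : Type*} [MeasurableSpace Ω] (P : Measure Ω) [IsProbabilityMeasure P]
    (X C : ℕ → Ω → ℝ) (f g : ℝ → ℝ) (hmodel : RandomCensorship P X C f g)
    (τ : ℝ)
    (hτH : endPoint (P.map (followUp (X 0) (C 0))) = (τ : EReal))
    (hτG : endPoint (P.map (C 0)) = (τ : EReal))
    (hτF : (τ : EReal) < endPoint (P.map (X 0)))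
    (hf_mono : MonotoneOn f {x : ℝ | 0 ≤ x ∧ (x : EReal) < endPoint (P.map (X 0))})
    (hf_cont : ContinuousOn f {x : ℝ | 0 ≤ x ∧ (x : EReal) < endPoint (P.map (X 0))})
    (k : ℝ → ℝ) (hk : IsStandardKernel k)
    (b : ℕ → ℝ) (hb_pos : ∀ n, 1 ≤ n → 0 < b n) (hb_zero : Tendsto b atTop (𝓝 0))
    (hb_inf : Tendsto (fun n : ℕ => (n : ℝ) * b n) atTop atTop)
    (ε : ℝ) (hε : 0 < ε) (hετ : ε < τ) :
    ∀ᵐ ω ∂P, Tendsto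
      (fun n : ℕ => ⨆ x ∈ Set.Icc ε (τ - ε),
        ENNReal.ofReal |smoothedGrenander k (b n) τ
          (fun i : Fin n => followUp (X i) (C i) ω)
          (fun i : Fin n => uncensored (X i) (C i) ω) x - f x|)
      atTop (𝓝 0) := by
  have hτ : 0 < τ := hε.trans hετ
  have hsub : Set.Icc 0 τ ⊆ {x : ℝ | 0 ≤ x ∧ (x : EReal) < endPoint (P.map (X 0))} := fun x hx =>
    ⟨hx.1, (EReal.coe_le_coe_iff.2 hx.2).trans_lt hτF⟩
  have hm := hf_mono.mono hsub
  have hc := hf_cont.mono hsub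
  have hKMmono : ∀ ω, ∀ n : ℕ, Monotone (kaplanMeier (fun i : Fin n => followUp (X i) (C i) ω)
      (fun i : Fin n => uncensored (X i) (C i) ω)) := fun ω n =>
    monotone_kaplanMeier (fun i => uncensored_nonneg _ _ _) fun i => uncensored_le_one _ _ _
  have hKM : ∀ᵐ ω ∂P, ∀ q : ℚ, 0 < (q : ℝ) → (q : ℝ) < τ → TendstoUniformlyOn
      (fun n : ℕ => kaplanMeier (fun i : Fin n => followUp (X i) (C i) ω)
        (fun i : Fin n => uncensored (X i) (C i) ω))
      (fun x => ∫ u in (0 : ℝ)..x, f u) atTop (Set.Icc 0 (q : ℝ)) := by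
    simp only [ae_all_iff]
    intro q hq0 hqτ
    refine ae_tendstoUniformlyOn_of_monotoneOn hq0 (fun n ω => (hKMmono ω n).monotoneOn _)
      ((continuousOn_primitive_Icc_zero hτ.le hc).mono (Set.Icc_subset_Icc_right hqτ.le))
      fun t ht => ?_
    have htτ : t < τ := ht.2.trans_lt hqτ
    refine hmodel.ae_tendsto_kaplanMeier ht.1 (hc.mono (Set.Icc_subset_Icc_right htτ.le))
      (hmodel.atRiskProb_pos ?_ ?_)
    · exact (hsub ⟨ht.1, htτ.le⟩).2
    · rw [hτG]; exact EReal.coe_lt_coe_iff.2 htτ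
  filter_upwards [hKM] with ω hω
  set G : ℕ → ℝ → ℝ := fun n => kaplanMeier (fun i : Fin n => followUp (X i) (C i) ω)
    (fun i : Fin n => uncensored (X i) (C i) ω)
  have hGlim : ∀ t, 0 < t → t < τ →
      TendstoUniformlyOn G (fun x => ∫ u in (0 : ℝ)..x, f u) atTop (Set.Icc 0 t) := by
    intro t ht0 htτ
    obtain ⟨q, hq1, hq2⟩ := exists_rat_btwn htτ
    exact (hω q (ht0.trans hq1) hq2).mono (Set.Icc_subset_Icc_right hq1.le)
  -- the constant `G n 0` is a convex minorant, so the set of convex minorants is not empty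
  have hconv : ∀ n, ConvexOn ℝ (Set.Icc 0 τ) (gcm (Set.Icc 0 τ) (G n)) := fun n =>
    convexOn_gcm (convexOn_const (G n 0) (convex_Icc _ _)) fun t ht => hKMmono ω n ht.1
  have hgcm : ∀ t, t < τ → TendstoUniformlyOn (fun n => gcm (Set.Icc 0 τ) (G n))
      (fun x => ∫ u in (0 : ℝ)..x, f u) atTop (Set.Icc 0 t) := fun t ht =>
    tendstoUniformlyOn_gcm hτ (convexOn_primitive hτ.le hm hc)
      (monotoneOn_primitive hmodel.nonneg_f hc) (continuousOn_primitive_Icc_zero hτ.le hc)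
      (fun n => (hKMmono ω n).monotoneOn _) hGlim ht
  refine tendsto_iSup_smoothing hk hb_pos hb_zero hε hc (fun n => ?_) fun s t hs ht =>
    tendstoUniformlyOn_leftDeriv hm hc hconv hgcm hs ht
  have := (hconv n).monotoneOn_leftDeriv
  rwa [interior_Icc] at this
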